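/- For an infinite word ${\bf w}=w_0w_1w_2\cdots$ and $i\ge 0$, let $p_{\bf w}(i)$ be the length of the shortest non-empty prefix $u$ of $w_iw_{i+1}w_{i+2}\cdots$ such that $u$ is a suffix of $w_0\cdots w_{i-1}$ or $w_0\cdots w_{i-1}$ is a suffix of $u$, with $p_{\bf w}(i)=\infty$ if no such $u$ exists. Let $P_{\bf w}(n)=\sum_{j=0}^{n-1}p_{\bf w}(j)$ and, for $n\ge 1$, $h_{\bf w}(n)=\frac1n P_{\bf w}(n)$. Let ${\bf pd}=0100010101000100\cdots$ be the period-doubling word, i.e., the unique infinite fixed point of the morphism $0\mapsto 01$, $1\mapsto 00$. Then $p_{\bf pd}(i)<\infty$ for all $i\ge 0$, and for all integers $n\ge 1$, \[ \left(\tfrac13\log_2 n-\tfrac1{18}\right)n+\tfrac49\le P_{\bf pd}(n)\le\left(\tfrac43\log_2 n+\tfrac{22}9\right)n+\tfrac59 \] and \[ \tfrac13\log_2 n-\tfrac1{18}\le h_{\bf pd}(n)\le\tfrac43\log_2 n+3. \] In particular, $h_{\bf pd}(n)=\Theta(\log n)$ as $n\to\infty$. Moreover, for all integers $\ell\ge 0$,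 \[ P_{\bf pd}(2^\ell)=\left(\tfrac59+\tfrac{2\ell}3\right)2^\ell+\tfrac12-\tfrac{(-1)^\ell}{18}. \] -/

import Mathlib

open Asymptotics Filter

/-- The factor `w i, w (i+1), …, w (i+n-1)` of length `n` starting at position `i`
of the infinite word `w`. -/
def factorAt {α : Type*} (w : ℕ → α) (i n : ℕ) : List α :=
  (List.range n).map fun k => w (i + k)

/-- `n ≥ 1` is the length of a repetition of `w` at position `i`: the length-`n` prefix `u` of
`w i, w (i+1), …` is a suffix of `w 0 ⋯ w (i-1)`, or `w 0 ⋯ w (i-1)` is a suffix of `u`. -/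
def IsRepetitionAt {α : Type*} (w : ℕ → α) (i n : ℕ) : Prop :=
  1 ≤ n ∧ (factorAt w i n <:+ factorAt w 0 i ∨ factorAt w 0 i <:+ factorAt w i n)

/-- The periodicity function: the least length of a repetition of `w` at position `i`,
and `⊤` if there is none. -/
noncomputable def periodicity {α : Type*} (w : ℕ → α) (i : ℕ) : ℕ∞ :=
  ⨅ (n : ℕ) (_ : IsRepetitionAt w i n), (n : ℕ∞)

/-- The summatory function of the periodicity function. -/
noncomputable def periodicitySum {α : Type*} (w : ℕ → α) (n : ℕ) : ℕ∞ :=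
  ∑ j ∈ Finset.range n, periodicity w j

/-- The periodic complexity function: the average of the first `n` values of the
periodicity function (meaningful for `n ≥ 1`). -/
noncomputable def periodicComplexity {α : Type*} (w : ℕ → α) (n : ℕ) : ENNReal :=
  (periodicitySum w n : ENNReal) / (n : ENNReal)

/-- The infinite word `w` is a fixed point of the morphism `φ`: the image of every finite prefix
of `w` is again a prefix of `w`. (For a morphism without empty images, as below, this says
that the image of `w` is `w`.) -/
def IsFixedWord {α : Type*} (φ : α → List α) (w : ℕ → α) : Prop :=
  ∀ n : ℕ, (factorAt w 0 n).flatMap φ = factorAt w 0 ((factorAt w 0 n).flatMap φ).length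

/-- The period-doubling morphism `0 ↦ 01`, `1 ↦ 00`. -/
def pdMorphism : Fin 2 → List (Fin 2) := ![[0, 1], [0, 0]]

/-- The period-doubling word: its letter in position `n` is that of the `n`-th iterate of the
morphism on `0`, a word of length `2 ^ n > n`. By `isFixedWord_pdMorphism_iff` below, it is
the unique fixed point of the morphism. -/
def pd (n : ℕ) : Fin 2 :=
  ((fun u : List (Fin 2) => u.flatMap pdMorphism)^[n] [0]).getD n 0

theorem factorAt_length {α : Type*} (w : ℕ → α) (i n : ℕ) : (factorAt w i n).length = n := by
  simp [factorAt]

theorem factorAt_zero_prefix {α : Type*} (w : ℕ → α) {m n : ℕ} (h : m ≤ n) :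
    factorAt w 0 m <+: factorAt w 0 n := by
  have : factorAt w 0 m = (factorAt w 0 n).take m := by
    simp [factorAt, ← List.map_take, List.take_range, h]
  rw [this]
  exact List.take_prefix _ _

theorem length_flatMap_pdMorphism (u : List (Fin 2)) :
    (u.flatMap pdMorphism).length = 2 * u.length := by
  induction u with
  | nil => rfl
  | cons a u ih =>
    have : (pdMorphism a).length = 2 := by fin_cases a <;> rfl
    simp [List.flatMap_cons, ih, this]; ring

theorem length_iterate_pdMorphism (m : ℕ) :
    ((fun u : List (Fin 2) => u.flatMap pdMorphism)^[m] [0]).length = 2 ^ m := by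
  induction m with
  | zero => rfl
  | succ m ih => rw [Function.iterate_succ_apply', length_flatMap_pdMorphism, ih]; ring

theorem flatMap_prefix {u v : List (Fin 2)} (h : u <+: v) :
    u.flatMap pdMorphism <+: v.flatMap pdMorphism := by
  obtain ⟨t, rfl⟩ := h
  simp

theorem iterate_pdMorphism_prefix {m n : ℕ} (h : m ≤ n) :
    (fun u : List (Fin 2) => u.flatMap pdMorphism)^[m] [0] <+:
      (fun u : List (Fin 2) => u.flatMap pdMorphism)^[n] [0] := by
  have step : ∀ k, (fun u : List (Fin 2) => u.flatMap pdMorphism)^[k] [0] <+: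
      (fun u : List (Fin 2) => u.flatMap pdMorphism)^[k + 1] [0] := by
    intro k
    induction k with
    | zero => exact ⟨[1], rfl⟩
    | succ k ih =>
      rw [Function.iterate_succ_apply', Function.iterate_succ_apply' _ (k + 1)]
      exact flatMap_prefix ih
  induction n, h using Nat.le_induction with
  | base => exact List.prefix_refl _
  | succ n _ ih => exact ih.trans (step n)

theorem factorAt_pd (m : ℕ) :
    factorAt pd 0 (2 ^ m) = (fun u : List (Fin 2) => u.flatMap pdMorphism)^[m] [0] := by
  apply List.ext_getElem
  · rw [factorAt_length, length_iterate_pdMorphism]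
  · intro k h1 h2
    have hk : k < ((fun u : List (Fin 2) => u.flatMap pdMorphism)^[k] [0]).length := by
      rw [length_iterate_pdMorphism]; exact Nat.lt_two_pow_self
    simp only [factorAt, List.getElem_map, List.getElem_range, zero_add, pd]
    rw [List.getD_eq_getElem _ _ hk]
    rcases le_total k m with h | h
    · exact (iterate_pdMorphism_prefix h).getElem hk
    · exact ((iterate_pdMorphism_prefix h).getElem h2).symm

theorem isFixedWord_pd : IsFixedWord pdMorphism pd := by
  intro n
  have h1 : (factorAt pd 0 n).flatMap pdMorphism <+: factorAt pd 0 (2 ^ (n + 1)) := by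
    rw [factorAt_pd, Function.iterate_succ_apply', ← factorAt_pd]
    exact flatMap_prefix (factorAt_zero_prefix _ Nat.lt_two_pow_self.le)
  have h2 := h1.length_le
  rw [factorAt_length] at h2
  exact (List.prefix_of_prefix_length_le h1 (factorAt_zero_prefix pd h2)
    (by rw [factorAt_length])).eq_of_length (by rw [factorAt_length])

/-- The period-doubling word is the unique fixed point of the period-doubling morphism. -/
theorem isFixedWord_pdMorphism_iff (w : ℕ → Fin 2) : IsFixedWord pdMorphism w ↔ w = pd := by
  refine ⟨fun hw => ?_, fun h => h ▸ isFixedWord_pd⟩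
  have h0 : w 0 = 0 := by
    have h := hw 1
    rw [length_flatMap_pdMorphism, factorAt_length] at h
    have h' : pdMorphism (w 0) = [w 0, w 1] := by
      simpa [factorAt, List.range_succ] using h
    revert h'
    generalize w 0 = a
    generalize w 1 = b
    revert a b
    decide
  have key : ∀ m, factorAt w 0 (2 ^ m) = factorAt pd 0 (2 ^ m) := by
    intro m
    rw [factorAt_pd]
    induction m with
    | zero => simp [factorAt, h0]
    | succ m ih =>
      rw [Function.iterate_succ_apply', ← ih]
      have h := hw (2 ^ m)
      rw [length_flatMap_pdMorphism, factorAt_length] at h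
      rw [h, pow_succ, mul_comm]
  funext k
  have h := congrArg (fun l => l.getD k 0) (key k)
  simpa [factorAt, List.getD_eq_getElem?_getD, Nat.lt_two_pow_self] using h

/-!
A repetition of length `n` at position `i` of `w` amounts to the equalities `w j = w (j + n)` for
all `j < i ≤ j + n` (`isRepetitionAt_iff`).  As `pd (2 * i) = 0` and `pd (2 * i + 1)` is the
complement of `pd i`, the repetitions of even length `2 * n` at position `2 * i` or `2 * i + 1`
correspond to those of length `n` at `i`.  Repetitions of odd length `n ≥ 3` at a position `m ≥ 2`
do not exist (`not_isRepetitionAt_pd_of_odd`): for `m ≥ 3` they would produce two consecutive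
letters `1` in `pd`.  Call the least length of a repetition at a position its period.  For `i ≥ 1`,
the period at `2 * i` is `1` exactly if `pd (i - 1) = 1`, and that at `2 * i + 1` is `1` exactly if
`pd i = 1`; where the period is not `1`, it is twice the period at `i`.  So these two periods are
`2, 2` if the period at `i` is `1`, and otherwise they are, in some order, `1` and twice the period
at `i`.

Writing `P` for the summatory function and `C n` for the number of positions `0 < i < n` of
period `1`, this gives `P (2 * n) = 2 * P n + n + C n` and `C (2 * n) + C n + 1 = n`, which
determine `P (2 ^ l)`.  The bounds for general `n` follow by monotonicity of `P`, with `l` such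
that `2 ^ l ≤ n < 2 ^ (l + 1)`.
-/

/-! ### Repetitions in terms of letters -/

theorem factorAt_eq_iff {α : Type*} (w : ℕ → α) (i j n : ℕ) :
    factorAt w i n = factorAt w j n ↔ ∀ k < n, w (i + k) = w (j + k) := by
  simp [factorAt, List.map_inj_left]

theorem factorAt_add {α : Type*} (w : ℕ → α) (i m n : ℕ) :
    factorAt w i (m + n) = factorAt w i m ++ factorAt w (i + m) n := by
  simp [factorAt, List.range_add, add_assoc, Function.comp_def]

theorem factorAt_suffix_iff {α : Type*} (w : ℕ → α) (i j m n : ℕ) (h : m ≤ n) :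
    factorAt w i m <:+ factorAt w j n ↔ ∀ k < m, w (i + k) = w (j + (n - m) + k) := by
  rw [← factorAt_eq_iff]
  obtain ⟨d, rfl⟩ := Nat.exists_eq_add_of_le' h
  rw [Nat.add_sub_cancel, factorAt_add]
  constructor
  · intro hs
    exact (List.suffix_of_suffix_length_le hs (List.suffix_append _ _)
      (by simp [factorAt_length])).eq_of_length (by simp [factorAt_length])
  · intro he
    rw [he]
    exact List.suffix_append _ _

theorem isRepetitionAt_iff {α : Type*} (w : ℕ → α) (i n : ℕ) :
    IsRepetitionAt w i n ↔ 1 ≤ n ∧ ∀ j < i, i ≤ j + n → w j = w (j + n) := by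
  unfold IsRepetitionAt
  refine and_congr_right fun _ => ?_
  -- A suffix of equal length is the whole word, so the shorter word decides which case applies.
  have hlen : ∀ a b : ℕ, a < b → ¬ (factorAt w i b <:+ factorAt w 0 a) ∧
      ¬ (factorAt w 0 b <:+ factorAt w i a) := by
    intro a b hab
    constructor <;> intro h <;> have := h.length_le <;> simp only [factorAt_length] at this <;> omega
  rcases lt_trichotomy n i with h | rfl | h
  · rw [or_iff_left (hlen n i h).2, factorAt_suffix_iff w _ _ _ _ h.le]
    constructor
    · intro H j hj hij
      have := H (j + n - i) (by omega)
      rw [show i + (j + n - i) = j + n by omega, show 0 + (i - n) + (j + n - i) = j by omega] at this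
      exact this.symm
    · intro H k hk
      rw [H (0 + (i - n) + k) (by omega) (by omega)]
      congr 1
      omega
  · rw [factorAt_suffix_iff w _ _ _ _ le_rfl, factorAt_suffix_iff w _ _ _ _ le_rfl]
    simp only [Nat.sub_self, add_zero, zero_add]
    constructor
    · rintro (H | H) j hj -
      · rw [← H j hj, add_comm]
      · rw [H j hj, add_comm]
    · intro H
      refine Or.inr fun k hk => ?_
      rw [H k hk (by omega), add_comm]
  · rw [or_iff_right (hlen i n h).1, factorAt_suffix_iff w _ _ _ _ h.le]
    constructor
    · intro H j hj _
      have := H j hj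
      rw [zero_add] at this
      rw [this]
      congr 1
      omega
    · intro H k hk
      rw [zero_add, H k hk (by omega)]
      congr 1
      omega

theorem periodicity_eq_of_isLeast {α : Type*} {w : ℕ → α} {i k : ℕ}
    (h : IsLeast {n | IsRepetitionAt w i n} k) : periodicity w i = k :=
  le_antisymm (iInf₂_le k h.1) (le_iInf₂ fun _ hn => Nat.cast_le.2 (h.2 hn))

/-! ### Letters of the period-doubling word -/

theorem pdMorphism_pd (i : ℕ) : pdMorphism (pd i) = [pd (2 * i), pd (2 * i + 1)] := by
  have h : ∀ n, (factorAt pd 0 n).flatMap pdMorphism = factorAt pd 0 (2 * n) := by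
    intro n
    have := isFixedWord_pd n
    rwa [length_flatMap_pdMorphism, factorAt_length] at this
  have h1 := h (i + 1)
  rw [factorAt_add, List.flatMap_append, h, mul_add, factorAt_add, List.append_cancel_left_eq] at h1
  simpa [factorAt, List.range_succ] using h1

theorem pd_two_mul (i : ℕ) : pd (2 * i) = 0 := by
  have h := pdMorphism_pd i
  revert h
  generalize pd i = a
  generalize pd (2 * i) = b
  generalize pd (2 * i + 1) = c
  revert a b c
  decide

theorem pd_two_mul_add_one (i : ℕ) : pd (2 * i + 1) = 1 - pd i := by
  have h := pdMorphism_pd i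
  revert h
  generalize pd i = a
  generalize pd (2 * i) = b
  generalize pd (2 * i + 1) = c
  revert a b c
  decide

theorem pd_two_mul_add_one_eq_zero_iff (i : ℕ) : pd (2 * i + 1) = 0 ↔ pd i = 1 := by
  rw [pd_two_mul_add_one]
  generalize pd i = a
  revert a
  decide

theorem pd_two_mul_add_one_inj (i j : ℕ) : pd (2 * i + 1) = pd (2 * j + 1) ↔ pd i = pd j := by
  rw [pd_two_mul_add_one, pd_two_mul_add_one, sub_right_inj]

theorem pd_eq_zero_of_even {n : ℕ} (h : Even n) : pd n = 0 := by
  obtain ⟨k, rfl⟩ := h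
  rw [← two_mul, pd_two_mul]

theorem not_pd_eq_one_and_succ (i : ℕ) : ¬ (pd i = 1 ∧ pd (i + 1) = 1) := by
  rintro ⟨h1, h2⟩
  rcases Nat.even_or_odd i with h | h
  · rw [pd_eq_zero_of_even h] at h1
    exact absurd h1 (by decide)
  · rw [pd_eq_zero_of_even h.add_one] at h2
    exact absurd h2 (by decide)

/-- If `n = 2 * m + 1`, two zeros here would mean that `pd` has the letters `11` at `m, m + 1`. -/
theorem not_pd_odd_eq_zero_and_next {n : ℕ} (hn : Odd n) : ¬ (pd n = 0 ∧ pd (n + 2) = 0) := by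
  obtain ⟨m, rfl⟩ := hn
  rw [show 2 * m + 1 + 2 = 2 * (m + 1) + 1 by ring, pd_two_mul_add_one_eq_zero_iff,
    pd_two_mul_add_one_eq_zero_iff]
  exact not_pd_eq_one_and_succ m

/-! ### Repetitions of the period-doubling word -/

theorem isRepetitionAt_pd_two_mul (i n : ℕ) :
    IsRepetitionAt pd (2 * i) (2 * n) ↔ IsRepetitionAt pd i n := by
  rw [isRepetitionAt_iff, isRepetitionAt_iff]
  refine and_congr (by omega) ⟨fun H j hj hij => ?_, fun H j hj hij => ?_⟩
  · rw [← pd_two_mul_add_one_inj, H (2 * j + 1) (by omega) (by omega)]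
    congr 1
    ring
  · obtain ⟨k, rfl | rfl⟩ := Nat.even_or_odd' j
    · rw [← mul_add, pd_two_mul, pd_two_mul]
    · rw [show 2 * k + 1 + 2 * n = 2 * (k + n) + 1 by ring, pd_two_mul_add_one_inj]
      exact H k (by omega) (by omega)

theorem isRepetitionAt_pd_two_mul_add_one (i n : ℕ) :
    IsRepetitionAt pd (2 * i + 1) (2 * n) ↔ IsRepetitionAt pd i n := by
  rw [isRepetitionAt_iff, isRepetitionAt_iff]
  refine and_congr (by omega) ⟨fun H j hj hij => ?_, fun H j hj hij => ?_⟩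
  · rw [← pd_two_mul_add_one_inj, H (2 * j + 1) (by omega) (by omega)]
    congr 1
    ring
  · obtain ⟨k, rfl | rfl⟩ := Nat.even_or_odd' j
    · rw [← mul_add, pd_two_mul, pd_two_mul]
    · rw [show 2 * k + 1 + 2 * n = 2 * (k + n) + 1 by ring, pd_two_mul_add_one_inj]
      exact H k (by omega) (by omega)

theorem isRepetitionAt_one_iff {α : Type*} (w : ℕ → α) (i : ℕ) :
    IsRepetitionAt w (i + 1) 1 ↔ w i = w (i + 1) := by
  rw [isRepetitionAt_iff]
  refine ⟨fun H => H.2 i (by omega) (by omega), fun h => ⟨le_rfl, fun j hj hij => ?_⟩⟩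
  rwa [show j = i by omega]

theorem isRepetitionAt_pd_two_mul_one (i : ℕ) :
    IsRepetitionAt pd (2 * (i + 1)) 1 ↔ pd i = 1 := by
  rw [show 2 * (i + 1) = 2 * i + 1 + 1 by ring, isRepetitionAt_one_iff,
    show 2 * i + 1 + 1 = 2 * (i + 1) by ring, pd_two_mul, pd_two_mul_add_one_eq_zero_iff]

theorem isRepetitionAt_pd_two_mul_add_one_one (i : ℕ) :
    IsRepetitionAt pd (2 * i + 1) 1 ↔ pd i = 1 := by
  rw [isRepetitionAt_one_iff, pd_two_mul, eq_comm, pd_two_mul_add_one_eq_zero_iff]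

theorem not_isRepetitionAt_pd_of_odd {m n : ℕ} (hm : 2 ≤ m) (hn : Odd n) (hn1 : n ≠ 1) :
    ¬ IsRepetitionAt pd m n := by
  rw [isRepetitionAt_iff]
  rintro ⟨-, H⟩
  have hn3 : 3 ≤ n := by
    obtain ⟨k, rfl⟩ := hn
    omega
  obtain rfl | hm3 : m = 2 ∨ 3 ≤ m := by omega
  · have h := H 1 (by omega) (by omega)
    rw [pd_eq_zero_of_even (n := 1 + n) (by rw [add_comm]; exact hn.add_one),
      show pd 1 = 1 by decide] at h
    exact absurd h (by decide)
  · -- The three positions `m - 3, m - 2, m - 1` contain two of the same parity, both compared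
    -- with a position of the opposite parity.
    obtain ⟨j, rfl⟩ := Nat.exists_eq_add_of_le' hm3
    have h0 := H j (by omega) (by omega)
    have h2 := H (j + 2) (by omega) (by omega)
    rcases Nat.even_or_odd j with hj | hj
    · rw [pd_eq_zero_of_even hj] at h0
      rw [pd_eq_zero_of_even (hj.add even_two), show j + 2 + n = j + n + 2 by ring] at h2
      exact not_pd_odd_eq_zero_and_next (hj.add_odd hn) ⟨h0.symm, h2.symm⟩
    · have hjn := hj.add_odd hn
      rw [pd_eq_zero_of_even hjn] at h0
      rw [show j + 2 + n = j + n + 2 by ring, pd_eq_zero_of_even (hjn.add even_two)] at h2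
      exact not_pd_odd_eq_zero_and_next hj ⟨h0, h2⟩

/-! ### Recursion for the periodicity function -/

theorem isLeast_one_of_isRepetitionAt {α : Type*} {w : ℕ → α} {i : ℕ}
    (h : IsRepetitionAt w i 1) : IsLeast {n | IsRepetitionAt w i n} 1 :=
  ⟨h, fun _ hn => hn.1⟩

/-- If `pd` has no repetition of length `1` at `m ≥ 2`, then all repetitions at `m` have even
length, and the least length is twice the one at `i`. The lemma is used for `m = 2 * i` and
`m = 2 * i + 1`, where `hR` holds. -/
theorem isLeast_two_mul {i m k : ℕ} (hm : 2 ≤ m) (h1 : ¬ IsRepetitionAt pd m 1)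
    (hR : ∀ n, IsRepetitionAt pd m (2 * n) ↔ IsRepetitionAt pd i n)
    (hk : IsLeast {n | IsRepetitionAt pd i n} k) :
    IsLeast {n | IsRepetitionAt pd m n} (2 * k) := by
  refine ⟨(hR k).2 hk.1, fun n hn => ?_⟩
  obtain ⟨t, rfl | rfl⟩ := Nat.even_or_odd' n
  · exact Nat.mul_le_mul_left 2 (hk.2 ((hR t).1 hn))
  · by_cases h : 2 * t + 1 = 1
    · exact absurd (h ▸ hn) h1
    · exact absurd hn (not_isRepetitionAt_pd_of_odd hm ⟨t, rfl⟩ h)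

theorem isLeast_pd_of_eq_one {i : ℕ} (hi : i ≠ 0) (h : IsLeast {n | IsRepetitionAt pd i n} 1) :
    IsLeast {n | IsRepetitionAt pd (2 * i) n} 2 ∧
      IsLeast {n | IsRepetitionAt pd (2 * i + 1) n} 2 := by
  obtain ⟨j, rfl⟩ := Nat.exists_eq_succ_of_ne_zero hi
  have hj : pd j = pd (j + 1) := (isRepetitionAt_one_iff pd j).1 h.1
  have hj1 : pd j ≠ 1 := fun h => not_pd_eq_one_and_succ j ⟨h, hj ▸ h⟩
  refine ⟨isLeast_two_mul (by omega) ?_ (isRepetitionAt_pd_two_mul _) h,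
    isLeast_two_mul (by omega) ?_ (isRepetitionAt_pd_two_mul_add_one _) h⟩
  · rwa [Nat.succ_eq_add_one, isRepetitionAt_pd_two_mul_one]
  · rwa [Nat.succ_eq_add_one, isRepetitionAt_pd_two_mul_add_one_one, ← hj]

theorem isLeast_pd_of_ne_one {i k : ℕ} (hi : i ≠ 0) (hk : k ≠ 1)
    (h : IsLeast {n | IsRepetitionAt pd i n} k) :
    (IsLeast {n | IsRepetitionAt pd (2 * i) n} 1 ∧
      IsLeast {n | IsRepetitionAt pd (2 * i + 1) n} (2 * k)) ∨
    (IsLeast {n | IsRepetitionAt pd (2 * i) n} (2 * k) ∧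
      IsLeast {n | IsRepetitionAt pd (2 * i + 1) n} 1) := by
  obtain ⟨j, rfl⟩ := Nat.exists_eq_succ_of_ne_zero hi
  have hj : pd j ≠ pd (j + 1) := fun e =>
    hk (h.unique (isLeast_one_of_isRepetitionAt ((isRepetitionAt_one_iff pd j).2 e)))
  have hj' : (pd j = 1 ∧ pd (j + 1) ≠ 1) ∨ (pd j ≠ 1 ∧ pd (j + 1) = 1) := by
    revert hj
    generalize pd j = a
    generalize pd (j + 1) = b
    revert a b
    decide
  rcases hj' with ⟨ha, hb⟩ | ⟨ha, hb⟩
  · refine Or.inl ⟨isLeast_one_of_isRepetitionAt ?_,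
      isLeast_two_mul (by omega) ?_ (isRepetitionAt_pd_two_mul_add_one _) h⟩
    · rwa [Nat.succ_eq_add_one, isRepetitionAt_pd_two_mul_one]
    · rwa [Nat.succ_eq_add_one, isRepetitionAt_pd_two_mul_add_one_one]
  · refine Or.inr ⟨isLeast_two_mul (by omega) ?_ (isRepetitionAt_pd_two_mul _) h,
      isLeast_one_of_isRepetitionAt ?_⟩
    · rwa [Nat.succ_eq_add_one, isRepetitionAt_pd_two_mul_one]
    · rwa [Nat.succ_eq_add_one, isRepetitionAt_pd_two_mul_add_one_one]

theorem isLeast_pd_zero : IsLeast {n | IsRepetitionAt pd 0 n} 1 :=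
  isLeast_one_of_isRepetitionAt ((isRepetitionAt_iff pd 0 1).2 ⟨le_rfl, fun _ h => by omega⟩)

theorem isLeast_pd_one : IsLeast {n | IsRepetitionAt pd 1 n} 2 := by
  have h2 : IsRepetitionAt pd 1 2 :=
    (isRepetitionAt_pd_two_mul_add_one 0 1).2 isLeast_pd_zero.1
  have h1 : ¬ IsRepetitionAt pd 1 1 := by
    rw [show (1 : ℕ) = 0 + 1 from rfl, isRepetitionAt_one_iff]
    decide
  refine ⟨h2, fun n hn => ?_⟩
  have hn0 : 1 ≤ n := hn.1
  have hn1 : n ≠ 1 := fun e => h1 (e ▸ hn)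
  omega

theorem exists_isLeast_pd (i : ℕ) : ∃ k, IsLeast {n | IsRepetitionAt pd i n} k := by
  induction i using Nat.strong_induction_on with
  | _ m ih =>
    obtain ⟨i, hm⟩ := Nat.even_or_odd' m
    rcases eq_or_ne i 0 with rfl | hi
    · rcases hm with rfl | rfl
      · exact ⟨1, isLeast_pd_zero⟩
      · exact ⟨2, isLeast_pd_one⟩
    · obtain ⟨k, hk⟩ := ih i (by omega)
      rcases eq_or_ne k 1 with rfl | hk1
      · have h := isLeast_pd_of_eq_one hi hk
        rcases hm with rfl | rfl
        exacts [⟨_, h.1⟩, ⟨_, h.2⟩]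
      · rcases isLeast_pd_of_ne_one hi hk1 hk with h | h <;> rcases hm with rfl | rfl
        exacts [⟨_, h.1⟩, ⟨_, h.2⟩, ⟨_, h.1⟩, ⟨_, h.2⟩]

/-- The periodicity function of the period-doubling word, with values in `ℕ`. -/
noncomputable def pdPeriod (i : ℕ) : ℕ := (periodicity pd i).toNat

theorem pdPeriod_eq_of_isLeast {i k : ℕ} (h : IsLeast {n | IsRepetitionAt pd i n} k) :
    pdPeriod i = k := by
  rw [pdPeriod, periodicity_eq_of_isLeast h, ENat.toNat_natCast]

theorem isLeast_pdPeriod (i : ℕ) : IsLeast {n | IsRepetitionAt pd i n} (pdPeriod i) := by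
  obtain ⟨k, hk⟩ := exists_isLeast_pd i
  rwa [pdPeriod_eq_of_isLeast hk]

theorem periodicity_pd (i : ℕ) : periodicity pd i = pdPeriod i :=
  periodicity_eq_of_isLeast (isLeast_pdPeriod i)

theorem pdPeriod_zero : pdPeriod 0 = 1 := pdPeriod_eq_of_isLeast isLeast_pd_zero

theorem pdPeriod_one : pdPeriod 1 = 2 := pdPeriod_eq_of_isLeast isLeast_pd_one

theorem pdPeriod_of_eq_one {i : ℕ} (hi : i ≠ 0) (h : pdPeriod i = 1) :
    pdPeriod (2 * i) = 2 ∧ pdPeriod (2 * i + 1) = 2 := by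
  have := isLeast_pd_of_eq_one hi (h ▸ isLeast_pdPeriod i)
  exact ⟨pdPeriod_eq_of_isLeast this.1, pdPeriod_eq_of_isLeast this.2⟩

theorem pdPeriod_of_ne_one {i : ℕ} (hi : i ≠ 0) (h : pdPeriod i ≠ 1) :
    (pdPeriod (2 * i) = 1 ∧ pdPeriod (2 * i + 1) = 2 * pdPeriod i) ∨
    (pdPeriod (2 * i) = 2 * pdPeriod i ∧ pdPeriod (2 * i + 1) = 1) :=
  (isLeast_pd_of_ne_one hi h (isLeast_pdPeriod i)).imp
    (fun h => ⟨pdPeriod_eq_of_isLeast h.1, pdPeriod_eq_of_isLeast h.2⟩)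
    (fun h => ⟨pdPeriod_eq_of_isLeast h.1, pdPeriod_eq_of_isLeast h.2⟩)

/-! ### The summatory function -/

/-- The summatory function of `pdPeriod`. -/
noncomputable def pdSum (n : ℕ) : ℕ := ∑ i ∈ Finset.range n, pdPeriod i

/-- The number of positions `0 < i < n` at which `pd` has period `1`. -/
noncomputable def pdOnes (n : ℕ) : ℕ :=
  ∑ i ∈ Finset.range n, if i ≠ 0 ∧ pdPeriod i = 1 then 1 else 0

theorem sum_range_two_mul (f : ℕ → ℕ) (n : ℕ) :
    ∑ i ∈ Finset.range (2 * n), f i = ∑ i ∈ Finset.range n, (f (2 * i) + f (2 * i + 1)) := by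
  induction n with
  | zero => rfl
  | succ n ih =>
    rw [Finset.sum_range_succ _ n, ← ih, mul_add, mul_one, Finset.sum_range_succ,
      Finset.sum_range_succ, add_assoc]

theorem pdSum_two_mul (n : ℕ) : pdSum (2 * n) = 2 * pdSum n + n + pdOnes n := by
  rw [pdSum, sum_range_two_mul, pdSum, pdOnes, Finset.mul_sum]
  nth_rw 3 [← Finset.card_range n]
  rw [Finset.card_eq_sum_ones, ← Finset.sum_add_distrib, ← Finset.sum_add_distrib]
  refine Finset.sum_congr rfl fun i _ => ?_
  rcases eq_or_ne i 0 with rfl | hi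
  · simp [pdPeriod_zero, pdPeriod_one]
  · by_cases h : pdPeriod i = 1
    · have := pdPeriod_of_eq_one hi h
      simp [hi, h, this]
    · simp only [h, and_false, if_false]
      rcases pdPeriod_of_ne_one hi h with h | h <;> omega

theorem pdOnes_two_mul {n : ℕ} (hn : n ≠ 0) : pdOnes (2 * n) + pdOnes n + 1 = n := by
  -- Each `0 < i < n` is either counted by `pdOnes n` or has one of `2 * i`, `2 * i + 1` counted by
  -- `pdOnes (2 * n)`; the position `i = 0` contributes to neither.
  have h : pdOnes (2 * n) + pdOnes n = ∑ i ∈ Finset.range n, if i = 0 then 0 else 1 := by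
    rw [pdOnes, sum_range_two_mul, pdOnes, ← Finset.sum_add_distrib]
    refine Finset.sum_congr rfl fun i _ => ?_
    rcases eq_or_ne i 0 with rfl | hi
    · simp [pdPeriod_one]
    · by_cases h : pdPeriod i = 1
      · have := pdPeriod_of_eq_one hi h
        simp [hi, h, this]
      · have hne : 2 * pdPeriod i ≠ 1 := by omega
        rcases pdPeriod_of_ne_one hi h with h' | h' <;> simp [hi, h, h', hne]
  obtain ⟨m, rfl⟩ := Nat.exists_eq_succ_of_ne_zero hn
  rw [h, Finset.sum_range_succ']
  simp

theorem pdOnes_two_pow (l : ℕ) : (pdOnes (2 ^ l) : ℝ) = 2 ^ l / 3 - 1 / 2 + (-1) ^ l / 6 := by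
  induction l with
  | zero => norm_num [pdOnes]
  | succ l ih =>
    have h : ((pdOnes (2 * 2 ^ l) + pdOnes (2 ^ l) + 1 : ℕ) : ℝ) = ((2 ^ l : ℕ) : ℝ) :=
      congrArg _ (pdOnes_two_mul (by positivity))
    push_cast at h
    rw [pow_succ' 2 l, pow_succ' (2 : ℝ) l, pow_succ (-1 : ℝ) l]
    linarith

theorem pdSum_two_pow (l : ℕ) :
    (pdSum (2 ^ l) : ℝ) = (5 / 9 + 2 * l / 3) * 2 ^ l + 1 / 2 - (-1) ^ l / 18 := by
  induction l with
  | zero => norm_num [pdSum, pdPeriod_zero]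
  | succ l ih =>
    rw [pow_succ' 2 l, pdSum_two_mul]
    push_cast
    rw [ih, pdOnes_two_pow]
    ring

theorem pdSum_mono : Monotone pdSum := fun _ _ h =>
  Finset.sum_le_sum_of_subset (Finset.range_mono h)

theorem periodicitySum_pd (n : ℕ) : periodicitySum pd n = pdSum n := by
  simp [periodicitySum, pdSum, periodicity_pd]

theorem periodicComplexity_pd_toReal (n : ℕ) :
    (periodicComplexity pd n).toReal = (pdSum n : ℝ) / n := by
  simp [periodicComplexity, periodicitySum_pd]

/-! ### Bounds -/

theorem pdSum_bounds {n : ℕ} (hn : 1 ≤ n) :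
    (1 / 3 * Real.logb 2 n - 1 / 18) * n + 4 / 9 ≤ (pdSum n : ℝ) ∧
      (pdSum n : ℝ) ≤ (4 / 3 * Real.logb 2 n + 22 / 9) * n + 5 / 9 := by
  set l := Nat.log 2 n with hl
  have hlo : 2 ^ l ≤ n := Nat.pow_log_le_self 2 (by omega)
  have hhi : n < 2 ^ (l + 1) := Nat.lt_pow_succ_log_self one_lt_two n
  have hn0 : (0 : ℝ) < n := by exact_mod_cast hn
  have hlo' : (2 : ℝ) ^ l ≤ n := by exact_mod_cast hlo
  have hhi' : (n : ℝ) ≤ 2 ^ (l + 1) := by exact_mod_cast hhi.le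
  have hlog1 : (l : ℝ) ≤ Real.logb 2 n := by
    rw [Real.le_logb_iff_rpow_le one_lt_two hn0, Real.rpow_natCast]
    exact hlo'
  have hlog2 : Real.logb 2 n ≤ l + 1 := by
    rw [Real.logb_le_iff_le_rpow one_lt_two hn0]
    exact_mod_cast hhi'
  have h1 : (pdSum (2 ^ l) : ℝ) ≤ pdSum n := by exact_mod_cast pdSum_mono hlo
  have h2 : (pdSum n : ℝ) ≤ pdSum (2 ^ (l + 1)) := by exact_mod_cast pdSum_mono hhi.le
  rw [pdSum_two_pow] at h1 h2
  push_cast at h2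
  have hs : ∀ k : ℕ, (-1 : ℝ) ^ k ≤ 1 ∧ -1 ≤ (-1 : ℝ) ^ k := fun k => by
    rcases neg_one_pow_eq_or ℝ k with h | h <;> rw [h] <;> norm_num
  have hl0 : (0 : ℝ) ≤ l := Nat.cast_nonneg l
  rw [pow_succ (2 : ℝ) l] at hhi' h2
  constructor
  · have h3 : (5 / 9 + 2 * (l : ℝ) / 3) * (n / 2) ≤ (5 / 9 + 2 * l / 3) * 2 ^ l :=
      mul_le_mul_of_nonneg_left (by linarith) (by positivity)
    have h4 : Real.logb 2 n * n ≤ (l + 1) * n := mul_le_mul_of_nonneg_right hlog2 hn0.le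
    linarith [(hs l).1]
  · have h3 : (5 / 9 + 2 * ((l : ℝ) + 1) / 3) * (2 ^ l * 2) ≤ (5 / 9 + 2 * (l + 1) / 3) * (n * 2) :=
      mul_le_mul_of_nonneg_left (by linarith) (by positivity)
    have h4 : (l : ℝ) * n ≤ Real.logb 2 n * n := mul_le_mul_of_nonneg_right hlog1 hn0.le
    linarith [(hs (l + 1)).2]

theorem periodicComplexity_pd_bounds {n : ℕ} (hn : 1 ≤ n) :
    1 / 3 * Real.logb 2 n - 1 / 18 ≤ (periodicComplexity pd n).toReal ∧
      (periodicComplexity pd n).toReal ≤ 4 / 3 * Real.logb 2 n + 3 := by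
  have hn1 : (1 : ℝ) ≤ n := by exact_mod_cast hn
  have hn0 : (0 : ℝ) < n := by linarith
  obtain ⟨h1, h2⟩ := pdSum_bounds hn
  rw [periodicComplexity_pd_toReal, le_div_iff₀ hn0, div_le_iff₀ hn0]
  constructor <;> linarith

theorem periodicComplexity_pd_isTheta :
    (fun n : ℕ => (periodicComplexity pd n).toReal) =Θ[atTop] fun n : ℕ => Real.log n := by
  have hlog2 : 0 < Real.log 2 := Real.log_pos one_lt_two
  -- For `n ≥ 2`, where `logb 2 n ≥ 1`, the additive constants are absorbed by the logarithm.
  have key : ∀ n : ℕ, 2 ≤ n → 0 < Real.log n ∧ 1 ≤ Real.logb 2 n ∧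
      Real.logb 2 n * Real.log 2 = Real.log n := by
    intro n hn
    have hn' : (2 : ℝ) ≤ n := by exact_mod_cast hn
    refine ⟨Real.log_pos (by linarith), ?_, div_mul_cancel₀ _ hlog2.ne'⟩
    rw [Real.le_logb_iff_rpow_le one_lt_two (by linarith), Real.rpow_one]
    exact hn'
  constructor
  · refine IsBigO.of_bound (13 / 3 / Real.log 2) ?_
    filter_upwards [eventually_ge_atTop 2] with n hn
    obtain ⟨h0, h1, h2⟩ := key n hn
    rw [Real.norm_of_nonneg ENNReal.toReal_nonneg, Real.norm_of_nonneg h0.le, ← h2]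
    have := (periodicComplexity_pd_bounds (by omega : 1 ≤ n)).2
    field_simp
    linarith
  · refine IsBigO.of_bound (18 / 5 * Real.log 2) ?_
    filter_upwards [eventually_ge_atTop 2] with n hn
    obtain ⟨h0, h1, h2⟩ := key n hn
    rw [Real.norm_of_nonneg ENNReal.toReal_nonneg, Real.norm_of_nonneg h0.le, ← h2]
    have := (periodicComplexity_pd_bounds (by omega : 1 ≤ n)).1
    rw [mul_right_comm]
    exact mul_le_mul_of_nonneg_right (by linarith) hlog2.le

theorem mainTheorem4 :
    -- all values of the periodicity function of `pd` are finite
    (∀ i : ℕ, periodicity pd i ≠ ⊤) ∧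
    -- bounds for the summatory function
    (∀ n : ℕ, 1 ≤ n →
      (1 / 3 * Real.logb 2 n - 1 / 18) * n + 4 / 9 ≤ ((periodicitySum pd n).toNat : ℝ) ∧
      ((periodicitySum pd n).toNat : ℝ) ≤ (4 / 3 * Real.logb 2 n + 22 / 9) * n + 5 / 9) ∧
    -- bounds for the periodic complexity
    (∀ n : ℕ, 1 ≤ n →
      1 / 3 * Real.logb 2 n - 1 / 18 ≤ (periodicComplexity pd n).toReal ∧
      (periodicComplexity pd n).toReal ≤ 4 / 3 * Real.logb 2 n + 3) ∧
    -- order of growth of the periodic complexity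
    ((fun n : ℕ => (periodicComplexity pd n).toReal) =Θ[atTop] fun n : ℕ => Real.log n) ∧
    -- exact values of the summatory function at powers of two
    (∀ l : ℕ, ((periodicitySum pd (2 ^ l)).toNat : ℝ) =
      (5 / 9 + 2 * l / 3) * 2 ^ l + 1 / 2 - (-1) ^ l / 18) := by
  refine ⟨fun i => ?_, fun n hn => ?_, fun n hn => periodicComplexity_pd_bounds hn,
    periodicComplexity_pd_isTheta, fun l => ?_⟩
  · rw [periodicity_pd]
    exact ENat.natCast_ne_top _
  · rw [periodicitySum_pd, ENat.toNat_natCast]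
    exact pdSum_bounds hn
  · rw [periodicitySum_pd, ENat.toNat_natCast]
    exact pdSum_two_pow l
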